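/- Let $\ell>0$, $T>0$, let $a_1,a_2$ be real constants with $a_1,a_2\ge\underline a>0$, and let $u_0\in L^2(0,\ell)$, $u_0\neq 0$. For $i=1,2$ let $u_i\in C([0,T];L^2(0,\ell))$ be a solution of the degenerate parabolic problem $$\begin{cases}\partial_t u_i-a_i\,\partial_x(x\,\partial_x u_i)=0, & x\in(0,\ell),\ t\in(0,T),\\ x\,\partial_x u_i(x,t)|_{x=0}=0,\quad u_i(\ell,t)=0, & t\in(0,T),\\ u_i(x,0)=u_0(x), & x\in(0,\ell).\end{cases}$$ Here a solution is understood as follows: $u_i(\cdot,0)=u_0$, and for every $t\in(0,T)$ the map $u_i$ is differentiable at $t$ with values in $L^2(0,\ell)$, $u_i(\cdot,t)$ has a weak derivative with $\int_0^\ell x|\partial_xu_i(x,t)|^2\,dx<\infty$, $x\,\partial_xu_i(\cdot,t)\in H^1(0,\ell)$, both boundary conditions hold in the sense of traces (limits of the continuous representatives), and $\partial_tu_i(\cdot,t)=a_i\,\partial_x(x\,\partial_xu_i(\cdot,t))$ in $L^2(0,\ell)$. Suppose that for some $t_0\in(0,T]$ $$\partial_t u_1(\cdot,t_0)=\partial_t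 u_2(\cdot,t_0)\quad\text{and}\quad \partial_x u_1(\cdot,t_0)=\partial_x u_2(\cdot,t_0)\quad\text{a.e. on }(0,\ell),$$ where $\partial_t$ is the derivative of the $L^2(0,\ell)$-valued map $u_i$ on $[0,T]$ (the left derivative if $t_0=T$) and $\partial_x$ is the weak derivative. Then $a_1=a_2$. -/

import Mathlib

open MeasureTheory Set Filter Topology
open scoped ContDiff

namespace DegenerateHeat

/-- The Hilbert space `H = L²(0, ℓ)` of real-valued functions. -/
abbrev L2 (ℓ : ℝ) : Type := Lp ℝ 2 (volume.restrict (Ioo (0 : ℝ) ℓ))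

/-- `v` is the weak (distributional) derivative of `u` on the open interval `(0, ℓ)`. -/
structure HasWeakDeriv (ℓ : ℝ) (u v : ℝ → ℝ) : Prop where
  locInt_fun : LocallyIntegrableOn u (Ioo 0 ℓ)
  locInt_deriv : LocallyIntegrableOn v (Ioo 0 ℓ)
  integral_eq : ∀ φ : ℝ → ℝ, ContDiff ℝ ∞ φ → HasCompactSupport φ → tsupport φ ⊆ Ioo 0 ℓ →
    ∫ x in Ioo 0 ℓ, u x * deriv φ x = - ∫ x in Ioo 0 ℓ, v x * φ x

/-- The function `g`, given almost everywhere on `(0, ℓ)`, has a representative that is continuous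
on `(0, ℓ)` and has limit `c` at the point `p` (used for the end points `p = 0` and `p = ℓ`). -/
def HasTrace (ℓ : ℝ) (g : ℝ → ℝ) (p c : ℝ) : Prop :=
  ∃ G : ℝ → ℝ, ContinuousOn G (Ioo 0 ℓ) ∧ g =ᵐ[volume.restrict (Ioo 0 ℓ)] G ∧
    Tendsto G (𝓝[Ioo 0 ℓ] p) (𝓝 c)

/-- `u` belongs to `H¹₁(0, ℓ)` and has weak derivative `v`: `u ∈ L²(0, ℓ)`,
`∫₀^ℓ x |u'|² dx < ∞` and `u(ℓ) = 0`. -/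
structure MemH1 (ℓ : ℝ) (u : L2 ℓ) (v : ℝ → ℝ) : Prop where
  weakDeriv : HasWeakDeriv ℓ u v
  energy : IntegrableOn (fun x => x * v x ^ 2) (Ioo 0 ℓ)
  trace_right : HasTrace ℓ u ℓ 0

/-- `u` belongs to `H²₁(0, ℓ)`, has weak derivative `v`, and `w = (x u')'`:
`u ∈ H¹₁(0, ℓ)`, and `x u' ∈ H¹(0, ℓ)` with weak derivative `w ∈ L²(0, ℓ)`. -/
structure MemH2 (ℓ : ℝ) (u : L2 ℓ) (v : ℝ → ℝ) (w : L2 ℓ) : Prop where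
  memH1 : MemH1 ℓ u v
  flux_memLp : MemLp (fun x => x * v x) 2 (volume.restrict (Ioo 0 ℓ))
  flux_weakDeriv : HasWeakDeriv ℓ (fun x => x * v x) w

/-- `u ∈ C([0, T]; L²(0, ℓ))` is a solution of
`∂ₜu = a ∂ₓ(x ∂ₓu)` in `(0, ℓ) × (0, T)`, `x ∂ₓu |_{x = 0} = 0`, `u(ℓ, ·) = 0`, `u(·, 0) = u₀`.
The values of `u` outside `[0, T]` are irrelevant. -/
structure IsSolution (ℓ T a : ℝ) (u₀ : L2 ℓ) (u : ℝ → L2 ℓ) : Prop where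
  continuousOn : ContinuousOn u (Icc 0 T)
  initial : u 0 = u₀
  equation : ∀ t ∈ Ioo 0 T, ∃ (v : ℝ → ℝ) (w : L2 ℓ),
    MemH2 ℓ (u t) v w ∧ HasTrace ℓ (fun x => x * v x) 0 0 ∧ HasDerivAt u (a • w) t

end DegenerateHeat

/-! Write `A z = (x z')'` with zero flux at `0` and `z(ℓ) = 0`; `A` is symmetric
(`IsPotential.integral_mul_comm`). Pairing the equation with a fixed `z` in its domain gives
`⟨∂ₜu(t₀), z⟩ = a ⟨u(t₀), A z⟩`, even at `t₀ = T` (`IsSolution.inner_deriv`). For `z = x^(n+1) -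
ℓ^(n+1)` one has `A z = (n+1)² x^n`, and monomials are complete in `L²`, so equal time derivatives
force `a₁ u₁(t₀) = a₂ u₂(t₀)`. Equal space derivatives make `u₁(t₀) - u₂(t₀)` constant. If `a₁ ≠
a₂`, then `u₁(t₀)` is itself constant, and the growth in `n` of the same identity makes it zero
(`IsSolution.const_eq_zero`). Backward uniqueness (`IsSolution.initial_eq_zero`) then gives `u₀ =
0`, a contradiction. -/

namespace DegenerateHeat

/-! ### Weak derivatives, primitives and traces on an interval. -/

/-- Exchange of the order of integration over the triangle `0 < r < x < ℓ`. -/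
theorem integral_mul_primitive {ℓ : ℝ} {f g : ℝ → ℝ}
    (hf : IntegrableOn f (Ioo 0 ℓ)) (hg : IntegrableOn g (Ioo 0 ℓ)) :
    ∫ x in Ioo 0 ℓ, f x * (∫ r in (0 : ℝ)..x, g r) =
      ∫ r in Ioo 0 ℓ, (∫ x in r..ℓ, f x) * g r := by
  have h1 : ∫ x in Ioo 0 ℓ, f x * (∫ r in (0 : ℝ)..x, g r) =
      ∫ x in Ioo 0 ℓ, ∫ r in Ioo 0 ℓ, ({z : ℝ × ℝ | z.2 < z.1}.indicator
        (fun z => f z.1 * g z.2)) (x, r) := by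
    refine setIntegral_congr_fun measurableSet_Ioo fun x hx => ?_
    have : ∀ r, ({z : ℝ × ℝ | z.2 < z.1}.indicator (fun z => f z.1 * g z.2)) (x, r) =
        (Iio x).indicator (fun r => f x * g r) r := fun r => by
      simp [indicator_apply]
    simp only [this]
    rw [setIntegral_indicator measurableSet_Iio, integral_const_mul,
      intervalIntegral.integral_of_le hx.1.le, integral_Ioc_eq_integral_Ioo, Ioo_inter_Iio,
      min_eq_right hx.2.le]
  have h2 : ∫ r in Ioo 0 ℓ, (∫ x in r..ℓ, f x) * g r =
      ∫ r in Ioo 0 ℓ, ∫ x in Ioo 0 ℓ, ({z : ℝ × ℝ | z.2 < z.1}.indicator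
        (fun z => f z.1 * g z.2)) (x, r) := by
    refine setIntegral_congr_fun measurableSet_Ioo fun r hr => ?_
    have : ∀ x, ({z : ℝ × ℝ | z.2 < z.1}.indicator (fun z => f z.1 * g z.2)) (x, r) =
        (Ioi r).indicator (fun x => f x * g r) x := fun x => by
      simp [indicator_apply]
    simp only [this]
    rw [setIntegral_indicator measurableSet_Ioi, integral_mul_const,
      intervalIntegral.integral_of_le hr.2.le, integral_Ioc_eq_integral_Ioo, Ioo_inter_Ioi,
      max_eq_right hr.1.le]
  rw [h1, h2]
  refine integral_integral_swap ?_
  exact (hf.mul_prod hg).indicator (measurableSet_lt measurable_snd measurable_fst)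

theorem exists_Icc_of_tsupport_subset {ℓ : ℝ} (hℓ : 0 < ℓ) {χ : ℝ → ℝ} (hc : HasCompactSupport χ)
    (hs : tsupport χ ⊆ Ioo 0 ℓ) :
    ∃ a b, 0 < a ∧ b < ℓ ∧ tsupport χ ⊆ Icc a b := by
  rcases (tsupport χ).eq_empty_or_nonempty with h | h
  · exact ⟨ℓ / 2, ℓ / 2, by linarith, by linarith, by simp [h]⟩
  · obtain ⟨a, ha, ha'⟩ := hc.isCompact.exists_isLeast h
    obtain ⟨b, hb, hb'⟩ := hc.isCompact.exists_isGreatest h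
    exact ⟨a, b, (hs ha).1, (hs hb).2, fun x hx => ⟨ha' hx, hb' hx⟩⟩

/-- A test function with vanishing integral is the derivative of a test function. -/
theorem exists_test_primitive {ℓ : ℝ} (hℓ : 0 < ℓ) {χ : ℝ → ℝ} (hd : ContDiff ℝ ∞ χ)
    (hc : HasCompactSupport χ) (hs : tsupport χ ⊆ Ioo 0 ℓ) (hi : ∫ x in Ioo 0 ℓ, χ x = 0) :
    ∃ φ : ℝ → ℝ, ContDiff ℝ ∞ φ ∧ HasCompactSupport φ ∧ tsupport φ ⊆ Ioo 0 ℓ ∧ deriv φ = χ := by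
  obtain ⟨a, b, ha, hb, hab⟩ := exists_Icc_of_tsupport_subset hℓ hc hs
  have hcont := hd.continuous
  have hzero : ∀ x, x ∉ Icc a b → χ x = 0 := fun x hx =>
    image_eq_zero_of_notMem_tsupport fun h => hx (hab h)
  have hder : ∀ x, HasDerivAt (fun y => ∫ r in (0 : ℝ)..y, χ r) (χ x) x := fun x =>
    hcont.integral_hasStrictDerivAt 0 x |>.hasDerivAt
  have hderiv : deriv (fun y => ∫ r in (0 : ℝ)..y, χ r) = χ := funext fun x => (hder x).deriv
  have hout : ∀ x, x ∉ Icc a b → ∫ r in (0 : ℝ)..x, χ r = 0 := by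
    intro x hx
    rcases lt_or_ge x a with h | h
    · rw [intervalIntegral.integral_congr (g := fun _ => 0)]
      · simp
      · intro r hr
        refine hzero r fun h' => ?_
        have := hr.2
        have : r < a := this.trans_lt (max_lt ha h)
        linarith [h'.1]
    · have hbx : b < x := by
        by_contra hh
        exact hx ⟨h, not_lt.1 hh⟩
      have e1 : ∫ r in (0 : ℝ)..ℓ, χ r = 0 := by
        rw [intervalIntegral.integral_of_le hℓ.le, integral_Ioc_eq_integral_Ioo, hi]
      -- The integral up to `ℓ` vanishes, and the rest, between `ℓ` and `x`, misses the support on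
      -- whichever side of `ℓ` the point `x` lies.
      rw [← intervalIntegral.integral_add_adjacent_intervals (b := ℓ)
        (hcont.intervalIntegrable _ _) (hcont.intervalIntegrable _ _), e1, zero_add,
        intervalIntegral.integral_congr (g := fun _ => 0)]
      · simp
      · intro r hr
        refine hzero r fun h' => ?_
        have : b < r := (lt_min hb hbx).trans_le hr.1
        linarith [h'.2]
  have hts : tsupport (fun y => ∫ r in (0 : ℝ)..y, χ r) ⊆ Icc a b := by
    refine closure_minimal (fun x hx => ?_) isClosed_Icc
    by_contra h
    exact hx (hout x h)
  refine ⟨fun y => ∫ r in (0 : ℝ)..y, χ r, ?_, ?_, ?_, hderiv⟩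
  · rw [contDiff_infty_iff_deriv, hderiv]
    exact ⟨fun x => (hder x).differentiableAt, hd⟩
  · exact isCompact_Icc.of_isClosed_subset (isClosed_tsupport _) hts
  · exact hts.trans fun x hx => ⟨ha.trans_le hx.1, hx.2.trans_lt hb⟩

theorem integrableOn_mul_test {ℓ : ℝ} {g φ : ℝ → ℝ} (hg : IntegrableOn g (Ioo 0 ℓ))
    (hφ : Continuous φ) : IntegrableOn (fun x => g x * φ x) (Ioo 0 ℓ) := by
  obtain ⟨C, hC⟩ := isCompact_Icc.exists_bound_of_continuousOn (hφ.continuousOn (s := Icc 0 ℓ))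
  refine Integrable.mul_bdd (c := C) hg hφ.aestronglyMeasurable ?_
  exact (ae_restrict_mem measurableSet_Ioo).mono fun x hx => hC x (Ioo_subset_Icc_self hx)

/-- Du Bois-Reymond: a function with vanishing weak derivative is constant. -/
theorem exists_const_of_integral_mul_deriv_eq_zero {ℓ : ℝ} (hℓ : 0 < ℓ) {g : ℝ → ℝ}
    (hg : IntegrableOn g (Ioo 0 ℓ))
    (h : ∀ φ : ℝ → ℝ, ContDiff ℝ ∞ φ → HasCompactSupport φ → tsupport φ ⊆ Ioo 0 ℓ →
      ∫ x in Ioo 0 ℓ, g x * deriv φ x = 0) :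
    ∃ c : ℝ, g =ᵐ[volume.restrict (Ioo 0 ℓ)] fun _ => c := by
  -- A bump of integral one: subtracting a multiple of it gives any test function mean zero, and the
  -- constant sought must be the mean of `g` against it.
  let B : ContDiffBump (ℓ / 2) := ⟨ℓ / 8, ℓ / 4, by linarith, by linarith⟩
  let ψ : ℝ → ℝ := B.normed volume
  have hψd : ContDiff ℝ ∞ ψ := B.contDiff_normed
  have hψc : HasCompactSupport ψ := B.hasCompactSupport_normed
  have hψs : tsupport ψ ⊆ Ioo 0 ℓ := by
    rw [B.tsupport_normed_eq, Real.closedBall_eq_Icc]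
    intro x hx
    have h1 : ℓ / 2 - ℓ / 4 ≤ x := hx.1
    have h2 : x ≤ ℓ / 2 + ℓ / 4 := hx.2
    constructor <;> linarith
  have hset : ∀ φ : ℝ → ℝ, tsupport φ ⊆ Ioo 0 ℓ → ∫ x in Ioo 0 ℓ, φ x = ∫ x, φ x := by
    intro φ hφ
    exact setIntegral_eq_integral_of_forall_compl_eq_zero fun x hx =>
      image_eq_zero_of_notMem_tsupport fun h => hx (hφ h)
  have hψi : ∫ x in Ioo 0 ℓ, ψ x = 1 := by rw [hset ψ hψs]; exact B.integral_normed
  set c := ∫ x in Ioo 0 ℓ, g x * ψ x with hc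
  refine ⟨c, ?_⟩
  have key : ∀ᵐ x ∂volume, x ∈ Ioo 0 ℓ → g x - c = 0 := by
    refine isOpen_Ioo.ae_eq_zero_of_integral_contDiff_smul_eq_zero ?_ ?_
    · exact (IntegrableOn.sub hg (integrableOn_const (by simp))).locallyIntegrableOn
    · intro φ hφd hφc hφs
      have hφint : IntegrableOn φ (Ioo 0 ℓ) :=
        (hφd.continuous.integrable_of_hasCompactSupport hφc).integrableOn
      have hψint : IntegrableOn ψ (Ioo 0 ℓ) :=
        (hψd.continuous.integrable_of_hasCompactSupport hψc).integrableOn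
      set m := ∫ x in Ioo 0 ℓ, φ x with hm
      obtain ⟨Φ, h1, h2, h3, h4⟩ := exists_test_primitive hℓ (χ := fun x => φ x - m * ψ x)
        (hφd.sub (contDiff_const.mul hψd))
        (hφc.sub hψc.mul_left)
        ((tsupport_sub _ _).trans (union_subset hφs ((tsupport_mul_subset_right).trans hψs)))
        (by rw [integral_sub hφint (hψint.const_mul m), integral_const_mul, hψi, ← hm]; ring)
      have h5 := h Φ h1 h2 h3
      rw [h4] at h5
      have e1 : ∫ x in Ioo 0 ℓ, g x * (φ x - m * ψ x) = (∫ x in Ioo 0 ℓ, g x * φ x) - m * c := by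
        rw [hc, ← integral_const_mul, ← integral_sub (integrableOn_mul_test hg hφd.continuous)
          ((integrableOn_mul_test hg hψd.continuous).const_mul m)]
        congr 1; ext x; ring
      rw [← setIntegral_eq_integral_of_forall_compl_eq_zero (s := Ioo 0 ℓ)]
      · have : ∫ x in Ioo 0 ℓ, φ x • (g x - c) = (∫ x in Ioo 0 ℓ, g x * φ x) - m * c := by
          rw [hm, ← integral_mul_const, ← integral_sub (integrableOn_mul_test hg hφd.continuous)
            (hφint.mul_const c)]
          congr 1; ext x; simp; ring
        rw [this, ← e1, h5]
      · intro x hx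
        rw [image_eq_zero_of_notMem_tsupport fun h => hx (hφs h), zero_smul]
  rw [EventuallyEq, ae_restrict_iff' measurableSet_Ioo]
  filter_upwards [key] with x hx hx'
  linarith [hx hx']

theorem intervalIntegrable_of_integrableOn_Ioo {ℓ : ℝ} (hℓ : 0 ≤ ℓ) {f : ℝ → ℝ}
    (hf : IntegrableOn f (Ioo 0 ℓ)) : IntervalIntegrable f volume 0 ℓ := by
  rw [intervalIntegrable_iff_integrableOn_Ioo_of_le hℓ]
  exact hf

theorem continuousOn_primitive_of_integrableOn_Ioo {ℓ : ℝ} (hℓ : 0 ≤ ℓ) {f : ℝ → ℝ}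
    (hf : IntegrableOn f (Ioo 0 ℓ)) : ContinuousOn (fun x => ∫ r in (0 : ℝ)..x, f r) (Icc 0 ℓ) := by
  have := intervalIntegral.continuousOn_primitive_interval'
    (intervalIntegrable_of_integrableOn_Ioo hℓ hf) left_mem_uIcc
  rwa [uIcc_of_le hℓ] at this

/-- A function with integrable weak derivative is the primitive of this derivative. -/
theorem HasWeakDeriv.exists_eq_primitive {ℓ : ℝ} (hℓ : 0 < ℓ) {g W : ℝ → ℝ}
    (h : HasWeakDeriv ℓ g W) (hg : IntegrableOn g (Ioo 0 ℓ)) (hW : IntegrableOn W (Ioo 0 ℓ)) :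
    ∃ c : ℝ, g =ᵐ[volume.restrict (Ioo 0 ℓ)] fun x => c + ∫ r in (0 : ℝ)..x, W r := by
  have hP : IntegrableOn (fun x => ∫ r in (0 : ℝ)..x, W r) (Ioo 0 ℓ) :=
    ((continuousOn_primitive_of_integrableOn_Ioo hℓ.le hW).integrableOn_Icc).mono_set
      Ioo_subset_Icc_self
  obtain ⟨c, hc⟩ := exists_const_of_integral_mul_deriv_eq_zero hℓ
    (g := fun x => g x - ∫ r in (0 : ℝ)..x, W r) (hg.sub hP) (by
      intro φ h1 h2 h3
      have hφ' : Continuous (deriv φ) := h1.continuous_deriv (by simp)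
      have hφi : IntegrableOn (deriv φ) (Ioo 0 ℓ) :=
        (hφ'.integrableOn_Icc (a := 0) (b := ℓ)).mono_set Ioo_subset_Icc_self
      have e1 : ∫ x in Ioo 0 ℓ, (∫ r in (0 : ℝ)..x, W r) * deriv φ x =
          - ∫ x in Ioo 0 ℓ, W x * φ x := by
        rw [← integral_neg]
        calc _ = ∫ x in Ioo 0 ℓ, deriv φ x * (∫ r in (0 : ℝ)..x, W r) := by
              simp only [mul_comm]
          _ = _ := integral_mul_primitive hφi hW
          _ = _ := by
              congr 1; ext r
              rw [intervalIntegral.integral_deriv_eq_sub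
                (fun x _ => (h1.differentiable (by simp)) x) (hφ'.intervalIntegrable _ _),
                image_eq_zero_of_notMem_tsupport (f := φ) (x := ℓ) fun h => lt_irrefl _ (h3 h).2]
              ring
      simp only [sub_mul]
      rw [integral_sub (integrableOn_mul_test hg hφ') (integrableOn_mul_test hP hφ'), e1,
        h.integral_eq φ h1 h2 h3]
      ring)
  refine ⟨c, ?_⟩
  filter_upwards [hc] with x hx
  linarith

theorem HasTrace.eq_of_ae_eq {ℓ p c : ℝ} {g H : ℝ → ℝ} (hℓ : 0 < ℓ) (h : HasTrace ℓ g p c)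
    (hp : p ∈ Icc 0 ℓ) (hH : ContinuousOn H (Icc 0 ℓ))
    (hgH : g =ᵐ[volume.restrict (Ioo 0 ℓ)] H) : H p = c := by
  obtain ⟨G, hG, hgG, hlim⟩ := h
  have heq : EqOn G H (Ioo 0 ℓ) :=
    Measure.eqOn_open_of_ae_eq (hgG.symm.trans hgH) isOpen_Ioo hG (hH.mono Ioo_subset_Icc_self)
  have hne : (𝓝[Ioo 0 ℓ] p).NeBot := by
    rw [← mem_closure_iff_nhdsWithin_neBot, closure_Ioo hℓ.ne]
    exact hp
  have h1 : Tendsto H (𝓝[Ioo 0 ℓ] p) (𝓝 (H p)) := (hH p hp).mono Ioo_subset_Icc_self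
  refine tendsto_nhds_unique (h1.congr' ?_) hlim
  filter_upwards [self_mem_nhdsWithin] with x hx using (heq hx).symm

/-! ### The operator `(x u')'` in integral form, and its symmetry. -/

/-- The derivative `u'` of the solution of `(x u')' = w` with vanishing flux at `0`. -/
noncomputable def slope (w : ℝ → ℝ) (s : ℝ) : ℝ := (∫ r in (0 : ℝ)..s, w r) / s

/-- `u` solves `(x u')' = w` on `(0, ℓ)` with vanishing flux at `0` and `u(ℓ) = 0`. -/
def IsPotential (ℓ : ℝ) (u w : ℝ → ℝ) : Prop :=
  u =ᵐ[volume.restrict (Ioo 0 ℓ)] fun x => -∫ s in x..ℓ, slope w s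

theorem abs_integral_le_sqrt {ℓ : ℝ} {w : ℝ → ℝ} (hw : MemLp w 2 (volume.restrict (Ioo 0 ℓ)))
    {s : ℝ} (hs : s ∈ Ioo 0 ℓ) :
    |∫ r in (0 : ℝ)..s, w r| ≤ √s * ((1 + ∫ r in Ioo 0 ℓ, w r ^ 2) / 2) := by
  have hs0 : 0 < √s := Real.sqrt_pos.2 hs.1
  have hss : √s * √s = s := Real.mul_self_sqrt hs.1.le
  have hsub : Ioo 0 s ⊆ Ioo 0 ℓ := Ioo_subset_Ioo_right hs.2.le
  have hsq : IntegrableOn (fun r => w r ^ 2) (Ioo 0 ℓ) := hw.integrable_sq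
  have hmono : ∫ r in Ioo 0 s, w r ^ 2 ≤ ∫ r in Ioo 0 ℓ, w r ^ 2 :=
    setIntegral_mono_set hsq (Eventually.of_forall fun r => sq_nonneg _) hsub.eventuallyLE
  -- Weighted AM-GM replaces Cauchy–Schwarz; the weight is chosen so that both terms integrate to
  -- order `√s` over `(0, s)`.
  have hpt : ∀ r, |w r| ≤ 1 / (2 * √s) + √s / 2 * w r ^ 2 := by
    intro r
    have h1 : 1 / (2 * √s) + √s / 2 * w r ^ 2 - |w r| = (1 - √s * |w r|) ^ 2 / (2 * √s) := by
      rw [← sq_abs (w r)]; field_simp; ring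
    have h2 : 0 ≤ (1 - √s * |w r|) ^ 2 / (2 * √s) := by positivity
    linarith
  rw [intervalIntegral.integral_of_le hs.1.le, integral_Ioc_eq_integral_Ioo]
  calc |∫ r in Ioo 0 s, w r| ≤ ∫ r in Ioo 0 s, |w r| := abs_integral_le_integral_abs
    _ ≤ ∫ r in Ioo 0 s, (1 / (2 * √s) + √s / 2 * w r ^ 2) := by
        refine integral_mono ?_ ?_ hpt
        · exact (IntegrableOn.mono_set (hw.integrable one_le_two) hsub).abs
        · exact (integrable_const _).add ((hsq.mono_set hsub).const_mul _)
    _ = √s / 2 + √s / 2 * ∫ r in Ioo 0 s, w r ^ 2 := by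
        rw [integral_add (integrable_const _) ((hsq.mono_set hsub).const_mul _),
          integral_const_mul, setIntegral_const]
        simp only [Real.volume_real_Ioo_of_le hs.1.le, smul_eq_mul]
        congr 1
        field_simp
        nlinarith
    _ ≤ √s * ((1 + ∫ r in Ioo 0 ℓ, w r ^ 2) / 2) := by nlinarith

/-- The preceding bound gives `|slope w s| ≤ C s^(-1/2)`, which is integrable at the degenerate end
point. -/
theorem integrableOn_slope {ℓ : ℝ} (hℓ : 0 < ℓ) {w : ℝ → ℝ}
    (hw : MemLp w 2 (volume.restrict (Ioo 0 ℓ))) : IntegrableOn (slope w) (Ioo 0 ℓ) := by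
  have hwi : IntegrableOn w (Ioo 0 ℓ) := hw.integrable one_le_two
  have hmeas : AEStronglyMeasurable (slope w) (volume.restrict (Ioo 0 ℓ)) := by
    refine ContinuousOn.aestronglyMeasurable ?_ measurableSet_Ioo
    exact ((continuousOn_primitive_of_integrableOn_Ioo hℓ.le hwi).mono Ioo_subset_Icc_self).div
      continuousOn_id fun x hx => hx.1.ne'
  have hpow : IntegrableOn (fun s : ℝ => s ^ (-(1 / 2) : ℝ)) (Ioo 0 ℓ) :=
    (intervalIntegrable_iff_integrableOn_Ioo_of_le hℓ.le).1
      (intervalIntegral.intervalIntegrable_rpow' (by norm_num))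
  refine (hpow.mul_const ((1 + ∫ r in Ioo 0 ℓ, w r ^ 2) / 2)).mono' hmeas ?_
  refine (ae_restrict_mem measurableSet_Ioo).mono fun s hs => ?_
  have hs0 : 0 < √s := Real.sqrt_pos.2 hs.1
  rw [Real.norm_eq_abs, slope, abs_div, abs_of_pos hs.1, div_le_iff₀ hs.1, Real.rpow_neg hs.1.le,
    ← Real.sqrt_eq_rpow]
  refine (abs_integral_le_sqrt hw hs).trans_eq ?_
  have hss : √s * √s = s := Real.mul_self_sqrt hs.1.le
  field_simp
  nlinarith

/-- Integration by parts done by Fubini, so no boundary terms appear. The right-hand side is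
symmetric in `g` and `w`, which is the source of the symmetry of the operator. -/
theorem IsPotential.integral_mul {ℓ : ℝ} (hℓ : 0 < ℓ) {u w g : ℝ → ℝ}
    (hw : MemLp w 2 (volume.restrict (Ioo 0 ℓ))) (hg : IntegrableOn g (Ioo 0 ℓ))
    (h : IsPotential ℓ u w) :
    ∫ x in Ioo 0 ℓ, u x * g x = -∫ s in Ioo 0 ℓ, s * (slope g s * slope w s) := by
  have h1 : ∫ x in Ioo 0 ℓ, u x * g x = -∫ x in Ioo 0 ℓ, (∫ s in x..ℓ, slope w s) * g x := by
    rw [← integral_neg]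
    refine integral_congr_ae ?_
    filter_upwards [h] with x hx
    rw [hx]; ring
  rw [h1, ← integral_mul_primitive (integrableOn_slope hℓ hw) hg]
  congr 1
  refine setIntegral_congr_fun measurableSet_Ioo fun s hs => ?_
  have : s ≠ 0 := hs.1.ne'
  simp only [slope]
  field_simp

/-- Symmetry of the operator `u ↦ (x u')'`. -/
theorem IsPotential.integral_mul_comm {ℓ : ℝ} (hℓ : 0 < ℓ) {u w u' w' : ℝ → ℝ}
    (hw : MemLp w 2 (volume.restrict (Ioo 0 ℓ))) (hw' : MemLp w' 2 (volume.restrict (Ioo 0 ℓ)))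
    (h : IsPotential ℓ u w) (h' : IsPotential ℓ u' w') :
    ∫ x in Ioo 0 ℓ, u x * w' x = ∫ x in Ioo 0 ℓ, u' x * w x := by
  rw [h.integral_mul hℓ hw (hw'.integrable one_le_two),
    h'.integral_mul hℓ hw' (hw.integrable one_le_two)]
  congr 1
  refine integral_congr_ae (.of_forall fun s => ?_)
  ring

/-- Two integrations: the zero flux at `0` removes the constant in `x u'`, and the trace at `ℓ`
fixes the constant in `u`. -/
theorem MemH2.isPotential {ℓ : ℝ} (hℓ : 0 < ℓ) {u : L2 ℓ} {v : ℝ → ℝ} {w : L2 ℓ}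
    (h : MemH2 ℓ u v w) (h0 : HasTrace ℓ (fun x => x * v x) 0 0) : IsPotential ℓ u w := by
  have hw : MemLp w 2 (volume.restrict (Ioo 0 ℓ)) := Lp.memLp w
  have hwi : IntegrableOn w (Ioo 0 ℓ) := hw.integrable one_le_two
  obtain ⟨c, hc⟩ := h.flux_weakDeriv.exists_eq_primitive hℓ
    (h.flux_memLp.integrable one_le_two) hwi
  have hc0 : c + ∫ r in (0 : ℝ)..0, w r = 0 := h0.eq_of_ae_eq
    (H := fun x => c + ∫ r in (0 : ℝ)..x, w r) hℓ (left_mem_Icc.2 hℓ.le)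
    (continuousOn_const.add (continuousOn_primitive_of_integrableOn_Ioo hℓ.le hwi)) hc
  rw [intervalIntegral.integral_same, add_zero] at hc0
  have hv : v =ᵐ[volume.restrict (Ioo 0 ℓ)] slope w := by
    filter_upwards [hc, ae_restrict_mem measurableSet_Ioo] with x hx hx'
    rw [slope, eq_div_iff hx'.1.ne', mul_comm, hx, hc0, zero_add]
  have hS := integrableOn_slope hℓ hw
  have hvi : IntegrableOn v (Ioo 0 ℓ) := hS.congr hv.symm
  obtain ⟨d, hd⟩ := h.memH1.weakDeriv.exists_eq_primitive hℓ
    ((Lp.memLp u).integrable one_le_two) hvi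
  have hd0 : d + ∫ r in (0 : ℝ)..ℓ, v r = 0 := h.memH1.trace_right.eq_of_ae_eq
    (H := fun x => d + ∫ r in (0 : ℝ)..x, v r) hℓ (right_mem_Icc.2 hℓ.le)
    (continuousOn_const.add (continuousOn_primitive_of_integrableOn_Ioo hℓ.le hvi)) hd
  rw [IsPotential]
  have hVI := intervalIntegrable_of_integrableOn_Ioo hℓ.le hvi
  filter_upwards [hd, ae_restrict_mem measurableSet_Ioo] with x hx hx'
  have hsplit := intervalIntegral.integral_interval_sub_left hVI
    (hVI.mono_set (by
      rw [uIcc_of_le hx'.1.le, uIcc_of_le hℓ.le]; exact Icc_subset_Icc_right hx'.2.le))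
  have hcongr : ∫ s in x..ℓ, v s = ∫ s in x..ℓ, slope w s := by
    rw [intervalIntegral.integral_of_le hx'.2.le, intervalIntegral.integral_of_le hx'.2.le,
      integral_Ioc_eq_integral_Ioo, integral_Ioc_eq_integral_Ioo]
    exact integral_congr_ae (ae_restrict_of_ae_restrict_of_subset
      (Ioo_subset_Ioo_left hx'.1.le) hv)
  rw [← hcongr, hx]
  linarith

theorem isPotential_pow (ℓ : ℝ) (n : ℕ) :
    IsPotential ℓ (fun x => x ^ (n + 1) - ℓ ^ (n + 1)) (fun x => ((n : ℝ) + 1) ^ 2 * x ^ n) := by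
  refine (ae_restrict_mem measurableSet_Ioo).mono fun x hx => ?_
  have h1 : ∫ s in x..ℓ, slope (fun x => ((n : ℝ) + 1) ^ 2 * x ^ n) s =
      ∫ s in x..ℓ, ((n : ℝ) + 1) * s ^ n := by
    refine intervalIntegral.integral_congr fun s hs => ?_
    rw [uIcc_of_le hx.2.le] at hs
    have hs0 : s ≠ 0 := (hx.1.trans_le hs.1).ne'
    have hn : (n : ℝ) + 1 ≠ 0 := by positivity
    simp only [slope, intervalIntegral.integral_const_mul, integral_pow]
    field_simp
    ring
  have hn : (n : ℝ) + 1 ≠ 0 := by positivity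
  simp only [h1, intervalIntegral.integral_const_mul, integral_pow]
  field_simp
  ring

/-! ### Inner products in `L²` and completeness of the monomials. -/

theorem memLp_of_continuous {ℓ : ℝ} {f : ℝ → ℝ} (hf : Continuous f) :
    MemLp f 2 (volume.restrict (Ioo 0 ℓ)) := by
  obtain ⟨C, hC⟩ := isCompact_Icc.exists_bound_of_continuousOn (hf.continuousOn (s := Icc 0 ℓ))
  exact MemLp.of_bound hf.aestronglyMeasurable C
    ((ae_restrict_mem measurableSet_Ioo).mono fun x hx => hC x (Ioo_subset_Icc_self hx))

theorem inner_eq_integral {ℓ : ℝ} (f g : L2 ℓ) : inner ℝ f g = ∫ x in Ioo 0 ℓ, f x * g x := by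
  rw [L2.inner_def]
  simp [mul_comm]

theorem inner_toLp {ℓ : ℝ} (f : L2 ℓ) {g : ℝ → ℝ} (hg : MemLp g 2 (volume.restrict (Ioo 0 ℓ))) :
    inner ℝ f (hg.toLp g) = ∫ x in Ioo 0 ℓ, f x * g x := by
  rw [inner_eq_integral]
  refine integral_congr_ae ?_
  filter_upwards [hg.coeFn_toLp] with x hx
  rw [hx]

/-- A function orthogonal to all monomials vanishes. -/
theorem eq_zero_of_integral_mul_pow_eq_zero {ℓ : ℝ} {f : L2 ℓ}
    (h : ∀ n : ℕ, ∫ x in Ioo 0 ℓ, f x * x ^ n = 0) : f = 0 := by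
  have hfi : IntegrableOn f (Ioo 0 ℓ) := (Lp.memLp f).integrable one_le_two
  have hpoly : ∀ p : Polynomial ℝ, ∫ x in Ioo 0 ℓ, f x * p.eval x = 0 := by
    intro p
    induction p using Polynomial.induction_on' with
    | add p q hp hq =>
      simp only [Polynomial.eval_add, mul_add]
      rw [integral_add (integrableOn_mul_test hfi p.continuous)
        (integrableOn_mul_test hfi q.continuous), hp, hq, add_zero]
    | monomial n a =>
      simp only [Polynomial.eval_monomial]
      calc _ = ∫ x in Ioo 0 ℓ, a * (f x * x ^ n) := by congr 1; ext x; ring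
        _ = 0 := by rw [integral_const_mul, h n, mul_zero]
  have hcont : ∀ φ : ℝ → ℝ, Continuous φ → ∫ x in Ioo 0 ℓ, f x * φ x = 0 := by
    intro φ hφ
    set N := ∫ x in Ioo 0 ℓ, |f x| with hN
    have hN0 : 0 ≤ N := integral_nonneg fun x => abs_nonneg _
    refine abs_eq_zero.1 (le_antisymm (le_of_forall_pos_le_add fun ε hε => ?_) (abs_nonneg _))
    obtain ⟨p, hp⟩ := exists_polynomial_near_of_continuousOn 0 ℓ φ hφ.continuousOn
      (ε / (N + 1)) (by positivity)
    have e1 : ∫ x in Ioo 0 ℓ, f x * φ x = ∫ x in Ioo 0 ℓ, f x * (φ x - p.eval x) := by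
      simp only [mul_sub]
      rw [integral_sub (integrableOn_mul_test hfi hφ) (integrableOn_mul_test hfi p.continuous),
        hpoly, sub_zero]
    rw [e1, zero_add]
    calc |∫ x in Ioo 0 ℓ, f x * (φ x - p.eval x)|
        ≤ ∫ x in Ioo 0 ℓ, |f x * (φ x - p.eval x)| := abs_integral_le_integral_abs
      _ ≤ ∫ x in Ioo 0 ℓ, |f x| * (ε / (N + 1)) := by
          refine setIntegral_mono_on ?_ (hfi.abs.mul_const _) measurableSet_Ioo fun x hx => ?_
          · exact (integrableOn_mul_test hfi (hφ.sub p.continuous)).abs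
          · rw [abs_mul, abs_sub_comm]
            exact mul_le_mul_of_nonneg_left (hp x (Ioo_subset_Icc_self hx)).le (abs_nonneg _)
      _ = N * (ε / (N + 1)) := by rw [integral_mul_const]
      _ ≤ ε := by
          rw [mul_div_assoc', div_le_iff₀ (by positivity)]
          nlinarith
  refine (Lp.eq_zero_iff_ae_eq_zero).2 ?_
  have := isOpen_Ioo.ae_eq_zero_of_integral_contDiff_smul_eq_zero (μ := volume)
    (hfi.locallyIntegrableOn) (fun g hg _ hgs => by
      refine (setIntegral_eq_integral_of_forall_compl_eq_zero (s := Ioo 0 ℓ) fun x hx => ?_).symm.trans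
        ?_
      · rw [image_eq_zero_of_notMem_tsupport fun h => hx (hgs h), zero_smul]
      · simpa [mul_comm] using hcont g hg.continuous)
  rw [EventuallyEq, ae_restrict_iff' measurableSet_Ioo]
  exact this

/-! ### Backward uniqueness. -/

theorem IsPotential.inner_comm {ℓ : ℝ} (hℓ : 0 < ℓ) {u w u' w' : L2 ℓ}
    (h : IsPotential ℓ u w) (h' : IsPotential ℓ u' w') : inner ℝ w u' = inner ℝ u w' := by
  rw [real_inner_comm, inner_eq_integral, inner_eq_integral]
  exact (h.integral_mul_comm hℓ (Lp.memLp w) (Lp.memLp w') h').symm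

theorem IsSolution.exists_isPotential {ℓ T a : ℝ} (hℓ : 0 < ℓ) {u₀ : L2 ℓ} {u : ℝ → L2 ℓ}
    (hu : IsSolution ℓ T a u₀ u) {t : ℝ} (ht : t ∈ Ioo 0 T) :
    ∃ w : L2 ℓ, IsPotential ℓ (u t) w ∧ HasDerivAt u (a • w) t := by
  obtain ⟨v, w, h1, h2, h3⟩ := hu.equation t ht
  exact ⟨w, h1.isPotential hℓ h2, h3⟩

/-- If a solution vanishes at time `τ`, it vanishes at time `τ / 2`. -/
theorem IsSolution.eq_zero_half {ℓ T a : ℝ} (hℓ : 0 < ℓ) {u₀ : L2 ℓ} {u : ℝ → L2 ℓ}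
    (hu : IsSolution ℓ T a u₀ u) {τ : ℝ} (hτ : τ ∈ Ioc 0 T) (h : u τ = 0) : u (τ / 2) = 0 := by
  have hτ0 := hτ.1
  have hτT := hτ.2
  -- By symmetry `⟨u(τ/2 + s), u(τ/2 - s)⟩` does not depend on `s`: it is `‖u(τ/2)‖²` at `s = 0` and
  -- `⟨u(τ), u(0)⟩ = 0` at `s = τ/2`. Only continuity is used at that last point, where the equation
  -- may fail.
  have hconst := constant_of_has_deriv_right_zero (a := 0) (b := τ / 2)
    (f := fun s => inner ℝ (u (τ / 2 + s)) (u (τ / 2 - s)))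
    (by
      refine ContinuousOn.inner (hu.continuousOn.comp (by fun_prop) fun s hs => ?_)
        (hu.continuousOn.comp (by fun_prop) fun s hs => ?_)
      · constructor <;> linarith [hs.1, hs.2]
      · constructor <;> linarith [hs.1, hs.2])
    (by
      intro s hs
      obtain ⟨w, hw, hd⟩ := hu.exists_isPotential hℓ (t := τ / 2 + s)
        ⟨by linarith [hs.1, hs.2], by linarith [hs.1, hs.2]⟩
      obtain ⟨w', hw', hd'⟩ := hu.exists_isPotential hℓ (t := τ / 2 - s)
        ⟨by linarith [hs.1, hs.2], by linarith [hs.1, hs.2]⟩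
      have h1 : HasDerivAt (fun s => u (τ / 2 + s)) (a • w) s := hd.comp_const_add (τ / 2) s
      have h2 : HasDerivAt (fun s => u (τ / 2 - s)) (-(a • w')) s := hd'.comp_const_sub (τ / 2) s
      have h3 := h1.inner ℝ h2
      have e : inner ℝ (u (τ / 2 + s)) (-(a • w')) + inner ℝ (a • w) (u (τ / 2 - s)) = 0 := by
        rw [inner_neg_right, real_inner_smul_left, real_inner_smul_right,
          hw.inner_comm hℓ hw']
        ring
      rw [e] at h3
      exact h3.hasDerivWithinAt)
  have h4 := hconst (τ / 2) ⟨by linarith, le_rfl⟩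
  simp only [add_halves, h, inner_zero_left, add_zero, sub_zero] at h4
  exact inner_self_eq_zero.1 h4.symm

/-- Backward uniqueness. -/
theorem IsSolution.initial_eq_zero {ℓ T a : ℝ} (hℓ : 0 < ℓ) {u₀ : L2 ℓ} {u : ℝ → L2 ℓ}
    (hu : IsSolution ℓ T a u₀ u) {τ : ℝ} (hτ : τ ∈ Ioc 0 T) (h : u τ = 0) : u₀ = 0 := by
  have hmem : ∀ n : ℕ, τ * (1 / 2) ^ n ∈ Ioc 0 T := fun n =>
    ⟨mul_pos hτ.1 (by positivity), (mul_le_of_le_one_right hτ.1.le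
      (pow_le_one₀ (by norm_num) (by norm_num))).trans hτ.2⟩
  have hzero : ∀ n : ℕ, u (τ * (1 / 2) ^ n) = 0 := by
    intro n
    induction n with
    | zero => simpa using h
    | succ n ih =>
      have := hu.eq_zero_half hℓ (hmem n) ih
      rwa [pow_succ, ← mul_assoc, mul_one_div]
  have hlim : Tendsto (fun n : ℕ => τ * (1 / 2 : ℝ) ^ n) atTop (𝓝[Icc 0 T] 0) := by
    refine tendsto_nhdsWithin_iff.2 ⟨?_, .of_forall fun n => Ioc_subset_Icc_self (hmem n)⟩
    simpa using (tendsto_pow_atTop_nhds_zero_of_lt_one (r := (1 / 2 : ℝ)) (by norm_num)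
      (by norm_num)).const_mul τ
  have h1 := (hu.continuousOn 0 ⟨le_rfl, hτ.1.le.trans hτ.2⟩).tendsto.comp hlim
  have h2 : Tendsto (fun n : ℕ => u (τ * (1 / 2) ^ n)) atTop (𝓝 0) := by
    simp only [hzero]
    exact tendsto_const_nhds
  rw [← hu.initial]
  exact tendsto_nhds_unique h1 h2

/-! ### The weak equation at time `t₀` and its consequences. -/

/-- Weak form of the equation at time `t₀`, including the final time. -/
theorem IsSolution.inner_deriv {ℓ T a : ℝ} (hℓ : 0 < ℓ) {u₀ : L2 ℓ} {u : ℝ → L2 ℓ}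
    (hu : IsSolution ℓ T a u₀ u) {t₀ : ℝ} (ht₀ : t₀ ∈ Ioc 0 T) {p : L2 ℓ}
    (hp : HasDerivWithinAt u p (Icc 0 T) t₀) {z ζ : L2 ℓ} (hz : IsPotential ℓ z ζ) :
    inner ℝ p z = a * inner ℝ (u t₀) ζ := by
  have hd : ∀ t ∈ Ioo 0 t₀, HasDerivAt (fun t => inner ℝ (u t) z) (a * inner ℝ (u t) ζ) t := by
    intro t ht
    obtain ⟨w, hw, h⟩ := hu.exists_isPotential hℓ ⟨ht.1, ht.2.trans_le ht₀.2⟩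
    have h1 := h.inner ℝ (hasDerivAt_const t z)
    rwa [inner_zero_right, zero_add, real_inner_smul_left, hw.inner_comm hℓ hz] at h1
  have hcont : ContinuousWithinAt u (Ioo 0 t₀) t₀ :=
    (hu.continuousOn t₀ ⟨ht₀.1.le, ht₀.2⟩).mono
      (Ioo_subset_Icc_self.trans (Icc_subset_Icc_right ht₀.2))
  have hmem : Ioo 0 t₀ ∈ 𝓝[<] t₀ := Ioo_mem_nhdsLT ht₀.1
  -- The equation is not assumed at `t₀ = T`; the left derivative there is the limit of the
  -- derivatives at earlier times.
  have h1 : HasDerivWithinAt (fun t => inner ℝ (u t) z) (a * inner ℝ (u t₀) ζ) (Iic t₀) t₀ := by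
    refine hasDerivWithinAt_Iic_of_tendsto_deriv (s := Ioo 0 t₀)
      (fun t ht => (hd t ht).differentiableAt.differentiableWithinAt)
      (hcont.inner continuousWithinAt_const) hmem ?_
    have h2 : Tendsto (fun t => a * inner ℝ (u t) ζ) (𝓝[<] t₀) (𝓝 (a * inner ℝ (u t₀) ζ)) := by
      have h3 : ContinuousWithinAt (fun t => a * inner ℝ (u t) ζ) (Ioo 0 t₀) t₀ :=
        continuousWithinAt_const.mul (hcont.inner continuousWithinAt_const)
      exact h3.tendsto.mono_left (nhdsWithin_le_of_mem hmem)
    refine h2.congr' ?_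
    filter_upwards [hmem] with t ht using (hd t ht).deriv.symm
  have h4 : HasDerivWithinAt (fun t => inner ℝ (u t) z) (inner ℝ p z) (Icc 0 T) t₀ := by
    have := hp.inner ℝ (hasDerivWithinAt_const t₀ (Icc 0 T) z)
    rwa [inner_zero_right, zero_add] at this
  have hU : UniqueDiffWithinAt ℝ (Icc 0 t₀) t₀ :=
    uniqueDiffOn_Icc ht₀.1 t₀ (right_mem_Icc.2 ht₀.1.le)
  exact hU.eq_deriv _ (h4.mono (Icc_subset_Icc_right ht₀.2)) (h1.mono Icc_subset_Iic_self)

/-- Weak form of the equation tested with `x ^ (n + 1) - ℓ ^ (n + 1)`. -/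
theorem IsSolution.integral_pow {ℓ T a : ℝ} (hℓ : 0 < ℓ) {u₀ : L2 ℓ} {u : ℝ → L2 ℓ}
    (hu : IsSolution ℓ T a u₀ u) {t₀ : ℝ} (ht₀ : t₀ ∈ Ioc 0 T) {p : L2 ℓ}
    (hp : HasDerivWithinAt u p (Icc 0 T) t₀) (n : ℕ) :
    ∫ x in Ioo 0 ℓ, p x * (x ^ (n + 1) - ℓ ^ (n + 1)) =
      ((n : ℝ) + 1) ^ 2 * (a * ∫ x in Ioo 0 ℓ, u t₀ x * x ^ n) := by
  have h1 : MemLp (fun x : ℝ => x ^ (n + 1) - ℓ ^ (n + 1)) 2 (volume.restrict (Ioo 0 ℓ)) :=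
    memLp_of_continuous (by fun_prop)
  have h2 : MemLp (fun x : ℝ => ((n : ℝ) + 1) ^ 2 * x ^ n) 2 (volume.restrict (Ioo 0 ℓ)) :=
    memLp_of_continuous (by fun_prop)
  have hpot : IsPotential ℓ (h1.toLp _) (h2.toLp _) := by
    have hslope : ∀ x ∈ Ioo 0 ℓ, ∀ s ∈ Ioo x ℓ, slope (h2.toLp _) s =
        slope (fun x : ℝ => ((n : ℝ) + 1) ^ 2 * x ^ n) s := by
      intro x hx s hs
      have hs0 := hx.1.trans hs.1
      rw [slope, slope, intervalIntegral.integral_of_le hs0.le,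
        intervalIntegral.integral_of_le hs0.le, integral_Ioc_eq_integral_Ioo,
        integral_Ioc_eq_integral_Ioo]
      congr 1
      exact integral_congr_ae (ae_restrict_of_ae_restrict_of_subset
        (Ioo_subset_Ioo_right hs.2.le) h2.coeFn_toLp)
    rw [IsPotential]
    filter_upwards [h1.coeFn_toLp, isPotential_pow ℓ n, ae_restrict_mem measurableSet_Ioo]
      with x hx hx' hx''
    rw [hx, hx', intervalIntegral.integral_of_le hx''.2.le,
      intervalIntegral.integral_of_le hx''.2.le, integral_Ioc_eq_integral_Ioo,
      integral_Ioc_eq_integral_Ioo]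
    congr 1
    exact setIntegral_congr_fun measurableSet_Ioo fun s hs => (hslope x hx'' s hs).symm
  have h3 := hu.inner_deriv hℓ ht₀ hp hpot
  rw [inner_toLp, inner_toLp] at h3
  rw [h3, mul_left_comm, ← integral_const_mul (((n : ℝ) + 1) ^ 2)]
  congr 1
  refine integral_congr_ae (.of_forall fun x => ?_)
  ring

/-- A solution that is constant in space at a time of differentiability vanishes there. -/
theorem IsSolution.const_eq_zero {ℓ T a : ℝ} (hℓ : 0 < ℓ) (ha : 0 < a) {u₀ : L2 ℓ} {u : ℝ → L2 ℓ}
    (hu : IsSolution ℓ T a u₀ u) {t₀ : ℝ} (ht₀ : t₀ ∈ Ioc 0 T) {p : L2 ℓ}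
    (hp : HasDerivWithinAt u p (Icc 0 T) t₀) {k : ℝ}
    (hk : u t₀ =ᵐ[volume.restrict (Ioo 0 ℓ)] fun _ => k) : k = 0 := by
  have hpi : IntegrableOn p (Ioo 0 ℓ) := (Lp.memLp p).integrable one_le_two
  set N := ∫ x in Ioo 0 ℓ, |p x| with hN
  -- The factor `(n+1)²` beats the `1/(n+1)` from integrating `x^n`, while the test function stays
  -- below `ℓ^(n+1)`. This replaces the trace at `ℓ`, which is unavailable when `t₀ = T`.
  have hbound : ∀ n : ℕ, ((n : ℝ) + 1) * (a * |k|) ≤ N := by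
    intro n
    have hℓn : 0 < ℓ ^ (n + 1) := pow_pos hℓ _
    have hn : (0 : ℝ) < (n : ℝ) + 1 := by positivity
    have e1 : ∫ x in Ioo 0 ℓ, u t₀ x * x ^ n = k * (ℓ ^ (n + 1) / (n + 1)) := by
      calc _ = ∫ x in Ioo 0 ℓ, k * x ^ n :=
            integral_congr_ae (by filter_upwards [hk] with x hx; rw [hx])
        _ = _ := by
            rw [integral_const_mul, ← integral_Ioc_eq_integral_Ioo,
              ← intervalIntegral.integral_of_le hℓ.le, _root_.integral_pow]
            simp
    have e2 := hu.integral_pow hℓ ht₀ hp n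
    rw [e1] at e2
    have e3 : |∫ x in Ioo 0 ℓ, p x * (x ^ (n + 1) - ℓ ^ (n + 1))| ≤ N * ℓ ^ (n + 1) := by
      rw [hN, ← integral_mul_const]
      refine abs_integral_le_integral_abs.trans ?_
      refine setIntegral_mono_on (integrableOn_mul_test hpi (by fun_prop)).abs
        (hpi.abs.mul_const _) measurableSet_Ioo fun x hx => ?_
      rw [abs_mul]
      refine mul_le_mul_of_nonneg_left ?_ (abs_nonneg _)
      have h1 : 0 ≤ x ^ (n + 1) := pow_nonneg hx.1.le _
      have h2 : x ^ (n + 1) ≤ ℓ ^ (n + 1) := pow_le_pow_left₀ hx.1.le hx.2.le _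
      rw [abs_le]
      constructor <;> linarith
    have e4 : ((n : ℝ) + 1) ^ 2 * (a * (k * (ℓ ^ (n + 1) / (n + 1)))) =
        ((n : ℝ) + 1) * (a * k) * ℓ ^ (n + 1) := by
      field_simp
    rw [e2, e4, abs_mul, abs_mul, abs_mul, abs_of_pos hn, abs_of_pos ha, abs_of_pos hℓn] at e3
    exact le_of_mul_le_mul_right e3 hℓn
  by_contra hk0
  have hpos : 0 < a * |k| := mul_pos ha (abs_pos.2 hk0)
  obtain ⟨n, hn⟩ := exists_nat_gt (N / (a * |k|))
  rw [div_lt_iff₀ hpos] at hn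
  linarith [hbound n]

end DegenerateHeat

/-! ### Conclusion. -/

theorem mainTheorem7 (ℓ T a_low a₁ a₂ t₀ : ℝ) (hℓ : 0 < ℓ)
    (ha_low : 0 < a_low) (ha₁ : a_low ≤ a₁) (ha₂ : a_low ≤ a₂)
    (u₀ : DegenerateHeat.L2 ℓ) (hu₀ : u₀ ≠ 0)
    (u₁ u₂ : ℝ → DegenerateHeat.L2 ℓ)
    (hu₁ : DegenerateHeat.IsSolution ℓ T a₁ u₀ u₁)
    (hu₂ : DegenerateHeat.IsSolution ℓ T a₂ u₀ u₂)
    (ht₀ : t₀ ∈ Ioc 0 T)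
    (h_time : ∃ p : DegenerateHeat.L2 ℓ,
      HasDerivWithinAt u₁ p (Icc 0 T) t₀ ∧ HasDerivWithinAt u₂ p (Icc 0 T) t₀)
    (h_space : ∃ q : ℝ → ℝ,
      DegenerateHeat.HasWeakDeriv ℓ (u₁ t₀) q ∧ DegenerateHeat.HasWeakDeriv ℓ (u₂ t₀) q) :
    a₁ = a₂ := by
  obtain ⟨p, hp₁, hp₂⟩ := h_time
  obtain ⟨q, hq₁, hq₂⟩ := h_space
  by_contra hne
  have hi₁ : IntegrableOn (u₁ t₀) (Ioo 0 ℓ) := (Lp.memLp (u₁ t₀)).integrable one_le_two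
  have hi₂ : IntegrableOn (u₂ t₀) (Ioo 0 ℓ) := (Lp.memLp (u₂ t₀)).integrable one_le_two
  obtain ⟨c, hc⟩ := DegenerateHeat.exists_const_of_integral_mul_deriv_eq_zero hℓ
    (g := fun x => u₁ t₀ x - u₂ t₀ x) (hi₁.sub hi₂) (by
      intro φ h1 h2 h3
      have hφ' : Continuous (deriv φ) := h1.continuous_deriv (by simp)
      simp only [sub_mul]
      rw [integral_sub (DegenerateHeat.integrableOn_mul_test hi₁ hφ')
        (DegenerateHeat.integrableOn_mul_test hi₂ hφ'), hq₁.integral_eq φ h1 h2 h3,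
        hq₂.integral_eq φ h1 h2 h3, sub_self])
  have hcomb : a₁ • u₁ t₀ - a₂ • u₂ t₀ = 0 := by
    refine DegenerateHeat.eq_zero_of_integral_mul_pow_eq_zero fun n => ?_
    have e₁ := hu₁.integral_pow hℓ ht₀ hp₁ n
    rw [hu₂.integral_pow hℓ ht₀ hp₂ n] at e₁
    have e := mul_left_cancel₀ (by positivity) e₁
    have hpow : Continuous fun x : ℝ => x ^ n := by fun_prop
    calc ∫ x in Ioo 0 ℓ, (a₁ • u₁ t₀ - a₂ • u₂ t₀ : DegenerateHeat.L2 ℓ) x * x ^ n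
        = ∫ x in Ioo 0 ℓ, (a₁ * (u₁ t₀ x * x ^ n) - a₂ * (u₂ t₀ x * x ^ n)) := by
          refine integral_congr_ae ?_
          filter_upwards [Lp.coeFn_sub (a₁ • u₁ t₀) (a₂ • u₂ t₀), Lp.coeFn_smul a₁ (u₁ t₀),
            Lp.coeFn_smul a₂ (u₂ t₀)] with x h1 h2 h3
          rw [h1, Pi.sub_apply, h2, h3, Pi.smul_apply, Pi.smul_apply, smul_eq_mul, smul_eq_mul]
          ring
      _ = 0 := by
          rw [integral_sub ((DegenerateHeat.integrableOn_mul_test hi₁ hpow).const_mul _)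
            ((DegenerateHeat.integrableOn_mul_test hi₂ hpow).const_mul _), integral_const_mul,
            integral_const_mul, e, sub_self]
  -- Eliminating `u₂` from `a₁ u₁ = a₂ u₂` and `u₁ - u₂ = c` gives `(a₁ - a₂) u₁ = -a₂ c`.
  have hk : u₁ t₀ =ᵐ[volume.restrict (Ioo 0 ℓ)] fun _ => -(a₂ * c) / (a₁ - a₂) := by
    have hcomb' : a₁ • u₁ t₀ = a₂ • u₂ t₀ := sub_eq_zero.1 hcomb
    have h1 := Lp.coeFn_smul a₁ (u₁ t₀)
    rw [hcomb'] at h1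
    filter_upwards [h1, Lp.coeFn_smul a₂ (u₂ t₀), hc] with x h1 h2 h3
    rw [h2, Pi.smul_apply, Pi.smul_apply, smul_eq_mul, smul_eq_mul] at h1
    rw [eq_div_iff (sub_ne_zero.2 hne)]
    linear_combination -h1 - a₂ * h3
  have hk0 := hu₁.const_eq_zero hℓ (ha_low.trans_le ha₁) ht₀ hp₁ hk
  refine hu₀ (hu₁.initial_eq_zero hℓ ht₀ ?_)
  rw [hk0] at hk
  exact Lp.eq_zero_iff_ae_eq_zero.2 hk
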